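/- **Setting.** Let $b_1,\dots,b_M$ be an orthonormal basis of $\mathbb{R}^M$ (after a rotation of coordinates, $b_m=e_m$ is the standard basis). Let $x[1],\dots,x[N]\in\mathbb{R}^M$ be samples with augmented versions $x[1'],\dots,x[N']$ that follow the orthogonal mixture model: $\langle b_m,x[i]\rangle\ge 0$ for all $i,m$; for each $i$, $\langle b_m,x[i]\rangle>0$ for at most one $m$; and $x[i']=\gamma[i]\,x[i]$ with $\gamma[i]>0$. Assume that every mode occurs, i.e. for every $m$ there is an $i$ with $\langle b_m,x[i]\rangle>0$, and let the pairwise importance $\alpha_{ij}>0$ ($i\ne j$) be fixed. Consider the 2-layer ReLU network with one hidden node $z(x)=\max(\langle w_1,x\rangle,0)\,w_2$, $w_1\in\mathbb{R}^M$, $w_2\in\mathbb{R}^n$, and the energy $$\mathcal{E}_\alpha(w_2,w_1)=\tfrac12\sum_{i}\sum_{j\neq i}\alpha_{ij}\bigl(\|z[i]-z[j]\|^2-\|z[i]-z[i']\|^2\bigr),\qquad z[i]=z(x[i]),\ z[i']=z(x[i']).$$ A *training trajectory* is a pair of continuous curves $w_1(t),w_2(t)$, $t\ge 0$, with $\|w_1(t)\|=\|w_2(t)\|=1$,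 which follows gradient ascent of $\mathcal{E}_\alpha$ under the unit-norm constraints: for every $t\ge0$ the right derivative of $w_l$ at $t$ is $g_l-\langle w_l,g_l\rangle w_l$, where $g_l$ is the gradient of $\mathcal{E}_\alpha$ with respect to $w_l$, computed by back-propagation with $\mathrm{ReLU}'(u)=1$ for $u>0$ and $\mathrm{ReLU}'(u)=0$ for $u\le 0$. An initialization is *admissible* if $\|w_1(0)\|=\|w_2(0)\|=1$ and $\langle b_m,w_1(0)\rangle\ge0$ for all $m$. **Theorem.** 1. From every admissible initialization there is a training trajectory defined for all $t\ge 0$. 2. For every training trajectory with admissible initialization, either $w_1(t)\to b_m$ as $t\to\infty$ for some $m$, or there is a time $T\ge0$ such that $w_1(t)=w_1(T)$ for all $t\ge T$ and $w_1(T)$ has at least two positive coordinates in the basis $b$ (the trajectory comes to rest at an equilibrium which mixes several modes). 3. The second case is exceptional: for almost every $w_0$ on the unit sphere of $\mathbb{R}^M$ (with respect to surface measure) with $\langle b_m,w_0\rangle\ge0$ for all $m$, every training trajectory with $w_1(0)=w_0$ satisfies $w_1(t)\to b_m$ as $t\to\infty$ for some $m$, i.e. a single mode is selected. -/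

import Mathlib

open MeasureTheory Filter Topology

noncomputable section

namespace OneHidReLU

/-- Euclidean space `ℝ^k`. -/
abbrev Vec (k : ℕ) : Type := EuclideanSpace ℝ (Fin k)

/-- Orthogonal mixture model with modes `b 1, …, b M` (an orthonormal basis), for the `N` samples
`x i` and their augmented versions `x' i`: in the basis `b` every sample has nonnegative
coordinates, at most one of them positive, and augmentation rescales a sample by a positive,
sample-dependent factor. -/
structure OrthogonalMixture {M N : ℕ} (b : OrthonormalBasis (Fin M) ℝ (Vec M))
    (x x' : Fin N → Vec M) : Prop where
  nonneg : ∀ i m, 0 ≤ inner ℝ (b m) (x i)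
  one_hot : ∀ i m l, 0 < inner ℝ (b m) (x i) → 0 < inner ℝ (b l) (x i) → m = l
  augmentation : ∀ i, ∃ γ : ℝ, 0 < γ ∧ x' i = γ • x i

/-- The hidden activation `ReLU(⟨w, x⟩)` of the single hidden node. -/
def hidden {M : ℕ} (w x : Vec M) : ℝ := max (inner ℝ w x) 0

/-- The ReLU gate (the derivative of ReLU at `⟨w, x⟩`): open exactly when `⟨w, x⟩ > 0`. -/
def gate {M : ℕ} (w x : Vec M) : ℝ := if 0 < inner ℝ w x then 1 else 0

/-- Output of the 2-layer ReLU network with one hidden node, lower-layer weight `w` and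
upper-layer weight `v`. -/
def output {M n : ℕ} (v : Vec n) (w x : Vec M) : Vec n := hidden w x • v

/-- The energy `½ tr ℂ_α[z, z]` for fixed pairwise importance `α`, that is
`½ ∑_i ∑_{j ≠ i} α_ij (‖z[i] - z[j]‖² - ‖z[i] - z[i']‖²)`. -/
def energy {M N n : ℕ} (α : Fin N → Fin N → ℝ) (x x' : Fin N → Vec M)
    (v : Vec n) (w : Vec M) : ℝ :=
  (1 / 2) * ∑ i, ∑ j ∈ Finset.univ.erase i, α i j *
    (‖output v w (x i) - output v w (x j)‖ ^ 2 - ‖output v w (x i) - output v w (x' i)‖ ^ 2)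

/-- Gradient of the energy in `v`. -/
def gradUpper {M N n : ℕ} (α : Fin N → Fin N → ℝ) (x x' : Fin N → Vec M)
    (v : Vec n) (w : Vec M) : Vec n :=
  ∑ i, ∑ j ∈ Finset.univ.erase i, α i j •
    ((hidden w (x i) - hidden w (x j)) • (output v w (x i) - output v w (x j))
      - (hidden w (x i) - hidden w (x' i)) • (output v w (x i) - output v w (x' i)))

/-- Gradient of the energy in `w`, computed by back-propagation through the ReLU gates
(at a kink of ReLU the gate is closed). -/
def gradLower {M N n : ℕ} (α : Fin N → Fin N → ℝ) (x x' : Fin N → Vec M)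
    (v : Vec n) (w : Vec M) : Vec M :=
  ∑ i, ∑ j ∈ Finset.univ.erase i, α i j •
    (inner ℝ v (output v w (x i) - output v w (x j)) •
        (gate w (x i) • x i - gate w (x j) • x j)
      - inner ℝ v (output v w (x i) - output v w (x' i)) •
        (gate w (x i) • x i - gate w (x' i) • x' i))

lemma hasFDerivAt_hidden {M : ℕ} (w x : Vec M) (h : x ≠ 0 → inner ℝ w x ≠ 0) :
    HasFDerivAt (fun w => hidden w x) (innerSL ℝ (gate w x • x)) w := by
  by_cases hx : x = 0
  · subst hx
    simpa [hidden] using hasFDerivAt_const (0 : ℝ) w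
  have hlin : HasFDerivAt (fun w : Vec M => inner ℝ w x) (innerSL ℝ x) w := by
    have := (innerSL ℝ x).hasFDerivAt (x := w)
    exact this.congr_of_eventuallyEq (Eventually.of_forall fun u => by
      simp [real_inner_comm])
  have hc : ContinuousAt (fun w : Vec M => inner ℝ w x) w := hlin.continuousAt
  rcases lt_or_gt_of_ne (h hx) with hn | hp
  · have : gate w x = 0 := by simp [gate, hn.le]
    rw [this]
    simp only [zero_smul, map_zero]
    refine (hasFDerivAt_const (0 : ℝ) w).congr_of_eventuallyEq ?_
    filter_upwards [hc.eventually (gt_mem_nhds hn)] with u hu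
    simp [hidden, le_of_lt hu]
  · have : gate w x = 1 := by simp [gate, hp]
    rw [this]
    simp only [one_smul]
    refine hlin.congr_of_eventuallyEq ?_
    filter_upwards [hc.eventually (lt_mem_nhds hp)] with u hu
    simp [hidden, le_of_lt hu]

/-- Away from the kinks of ReLU, `gradLower` is the gradient of the energy in `w`. -/
theorem hasGradientAt_energy_lower {M N n : ℕ} (α : Fin N → Fin N → ℝ) (x x' : Fin N → Vec M)
    (v : Vec n) (w : Vec M) (h : ∀ i, x i ≠ 0 → inner ℝ w (x i) ≠ 0)
    (h' : ∀ i, x' i ≠ 0 → inner ℝ w (x' i) ≠ 0) :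
    HasGradientAt (fun w => energy α x x' v w) (gradLower α x x' v w) w := by
  rw [hasGradientAt_iff_hasFDerivAt]
  have ho : ∀ y : Vec M, (y ≠ 0 → inner ℝ w y ≠ 0) →
      HasFDerivAt (fun w => output v w y) ((innerSL ℝ (gate w y • y)).smulRight v) w :=
    fun y hy => (hasFDerivAt_hidden w y hy).smul_const v
  have hE := (HasFDerivAt.fun_sum (u := Finset.univ) (x := w) fun i _ =>
    HasFDerivAt.fun_sum (u := Finset.univ.erase i) fun j _ =>
      (((ho (x i) (h i)).sub (ho (x j) (h j))).norm_sq.sub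
        ((ho (x i) (h i)).sub (ho (x' i) (h' i))).norm_sq).const_mul (α i j)).const_mul (1 / 2 : ℝ)
  refine hE.congr_fderiv ?_
  ext u
  simp only [gradLower, InnerProductSpace.toDual_apply_apply, sum_inner, inner_smul_left,
    inner_sub_left, inner_sub_right, smul_apply, sum_apply,
    sub_apply, ContinuousLinearMap.comp_apply, innerSL_apply_apply,
    ContinuousLinearMap.smulRight_apply, inner_smul_right, Finset.mul_sum, smul_eq_mul,
    conj_trivial, output]
  refine Finset.sum_congr rfl fun i _ => Finset.sum_congr rfl fun j _ => ?_
  simp [inner_sub_left, inner_sub_right, inner_smul_left, inner_smul_right]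
  ring

/-- `gradUpper` is the gradient of the energy in `v`. -/
theorem hasGradientAt_energy_upper {M N n : ℕ} (α : Fin N → Fin N → ℝ) (x x' : Fin N → Vec M)
    (v : Vec n) (w : Vec M) :
    HasGradientAt (fun v => energy α x x' v w) (gradUpper α x x' v w) v := by
  rw [hasGradientAt_iff_hasFDerivAt]
  have ho : ∀ y : Vec M, HasFDerivAt (fun v : Vec n => output v w y)
      (hidden w y • ContinuousLinearMap.id ℝ (Vec n)) v :=
    fun y => (hasFDerivAt_id v).const_smul (hidden w y)
  have hE := (HasFDerivAt.fun_sum (u := Finset.univ) (x := v) fun i _ =>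
    HasFDerivAt.fun_sum (u := Finset.univ.erase i) fun j _ =>
      (((ho (x i)).sub (ho (x j))).norm_sq.sub
        ((ho (x i)).sub (ho (x' i))).norm_sq).const_mul (α i j)).const_mul (1 / 2 : ℝ)
  refine hE.congr_fderiv ?_
  ext u
  simp only [gradUpper, InnerProductSpace.toDual_apply_apply, sum_inner, inner_smul_left,
    inner_sub_left, inner_sub_right, Finset.mul_sum, output]
  simp only [smul_apply, sum_apply, Finset.mul_sum,
    smul_eq_mul]
  refine Finset.sum_congr rfl fun i _ => Finset.sum_congr rfl fun j _ => ?_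
  simp [inner_sub_left, inner_sub_right, inner_smul_left, inner_smul_right]
  ring

/-- Orthogonal projection of `g` to the tangent space at `u` of the unit sphere (`‖u‖ = 1`). -/
def tangent {k : ℕ} (u g : Vec k) : Vec k := g - inner ℝ u g • u

/-- `t ↦ (v t, w t)`, `t ≥ 0`, is a training trajectory: gradient ascent flow of the energy with
fixed `α` under the constraints `‖v‖ = 1`, `‖w‖ = 1`.  The right-hand side is discontinuous where a
gate closes, so the velocity is the forward (right) derivative. -/
structure IsTrajectory {M N n : ℕ} (α : Fin N → Fin N → ℝ) (x x' : Fin N → Vec M)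
    (v : ℝ → Vec n) (w : ℝ → Vec M) : Prop where
  continuousOn_upper : ContinuousOn v (Set.Ici 0)
  continuousOn_lower : ContinuousOn w (Set.Ici 0)
  norm_upper : ∀ t, 0 ≤ t → ‖v t‖ = 1
  norm_lower : ∀ t, 0 ≤ t → ‖w t‖ = 1
  flow_upper : ∀ t, 0 ≤ t →
    HasDerivWithinAt v (tangent (v t) (gradUpper α x x' (v t) (w t))) (Set.Ici t) t
  flow_lower : ∀ t, 0 ≤ t →
    HasDerivWithinAt w (tangent (w t) (gradLower α x x' (v t) (w t))) (Set.Ici t) t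

end OneHidReLU

end

noncomputable section

namespace OneHidReLU

/-! ### Comparison for right derivatives -/

/-! All outputs are multiples of `v`, so the gradient in `v` is radial and has no tangential part
(`tangent_gradUpper`). A nonzero sample carries exactly one mode, so its gate is open exactly when
the coordinate of `w` along that mode is positive. In the basis `b` the lower layer therefore
follows the spherical flow of `S_I u`, where `S` is a fixed symmetric matrix and `I` is the set of
positive coordinates of `u` (`repr_gradLower`). Distinct modes repel: the off-diagonal entries of
`S` are strictly negative (`interaction_neg`).

Consequently a lost coordinate never returns. While `I` is constant, the Rayleigh quotient `λ` of
`S_I` increases. The least eigenvalue `μ` of `S_I` has a positive eigenvector `p`, and `⟨p, u⟩' = (μ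
- λ)⟨p, u⟩`. If `λ > μ` at some time, then `⟨p, u⟩` falls at least linearly although it is bounded
below by a positive constant, which is impossible if no coordinate is ever lost. Hence either a
coordinate dies in finite time or `u` rests on the ray of `p` (`rest_of_posSupport_const`).
Induction on the support gives the dichotomy; the same induction, with normalised linear flows glued
at exit times, gives existence.

For the exceptional set, count dimensions. Bad initial values with support `I` lie either on the ray
of `p`, with `|I| ≥ 2`, or on backward linear flows of bad values with smaller support `J`. Time
adds one parameter, so the cone over them has dimension at most `(|J| - 1) + 1 ≤ |I| - 1`
(`smoothlyCovered_unselectedCone`). It is Lebesgue null, and polar coordinates carry this over to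
the sphere. -/

theorem nonpos_of_deriv_right_le {f f' : ℝ → ℝ} {a b K : ℝ} (hab : a ≤ b)
    (hf : ContinuousOn f (Set.Icc a b))
    (hf' : ∀ t ∈ Set.Ico a b, HasDerivWithinAt f (f' t) (Set.Ici t) t)
    (bound : ∀ t ∈ Set.Ico a b, 0 ≤ f t → f' t ≤ K * f t) (ha : f a ≤ 0) : f b ≤ 0 := by
  by_contra! hb
  -- The barrier `ε * exp ((K + 1) * (t - a))` equals `f b / 2` at `b`. Its rate `K + 1` exceeds
  -- `K`, so `f` cannot cross it.
  set ε : ℝ := f b / 2 * Real.exp (-((K + 1) * (b - a))) with hε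
  have hε0 : 0 < ε := by positivity
  have key := image_le_of_deriv_right_lt_deriv_boundary hf hf'
    (B := fun t => ε * Real.exp ((K + 1) * (t - a)))
    (B' := fun t => ε * (Real.exp ((K + 1) * (t - a)) * ((K + 1) * 1)))
    (ha.trans (by positivity))
    (fun t => ((((hasDerivAt_id t).sub_const a).const_mul (K + 1)).exp).const_mul ε)
    (fun t ht h => by
      have hpos : 0 < f t := by rw [h]; positivity
      have := bound t ht hpos.le
      have h2 : ε * (Real.exp ((K + 1) * (t - a)) * ((K + 1) * 1)) = (K + 1) * f t := by
        rw [h]; ring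
      rw [h2]; linarith)
  have := key (Set.right_mem_Icc.2 hab)
  simp only [hε, mul_assoc, ← Real.exp_add] at this
  simp at this
  linarith

theorem le_of_deriv_right_le {f f' : ℝ → ℝ} {a b C : ℝ} (hab : a ≤ b)
    (hf : ContinuousOn f (Set.Icc a b))
    (hf' : ∀ t ∈ Set.Ico a b, HasDerivWithinAt f (f' t) (Set.Ici t) t)
    (bound : ∀ t ∈ Set.Ico a b, f' t ≤ C) : f b ≤ f a + C * (b - a) := by
  have := image_le_of_deriv_right_le_deriv_boundary hf hf'
    (B := fun t => f a + C * (t - a)) (B' := fun _ => C) (by simp) (by fun_prop)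
    (fun t _ => by
      simpa using ((((hasDerivAt_id t).sub_const a).const_mul C).const_add (f a)).hasDerivWithinAt)
    bound
  exact this (Set.right_mem_Icc.2 hab)

/-! ### Principal minors of a symmetric matrix with negative off-diagonal entries -/

/-- The principal minor of `S` on the coordinates `I`, extended by zero to all of `ℝ^M`. -/
def minor {M : ℕ} (S : Matrix (Fin M) (Fin M) ℝ) (I : Finset (Fin M)) : Vec M →L[ℝ] Vec M :=
  Matrix.toEuclideanCLM (𝕜 := ℝ) (Matrix.of fun m l => if m ∈ I ∧ l ∈ I then S m l else 0)

section Dynamics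
variable {M : ℕ} {S : Matrix (Fin M) (Fin M) ℝ} {I : Finset (Fin M)}

theorem minor_apply (S : Matrix (Fin M) (Fin M) ℝ) (I : Finset (Fin M)) (u : Vec M) (m : Fin M) :
    minor S I u m = if m ∈ I then ∑ l ∈ I, S m l * u l else 0 := by
  have : minor S I u m = ∑ l, (if m ∈ I ∧ l ∈ I then S m l else 0) * u l := rfl
  rw [this]
  split_ifs with h <;> simp [h]

theorem inner_eq_sum (u z : Vec M) : inner ℝ u z = ∑ m, u m * z m := by
  simp [PiLp.inner_apply, mul_comm]

theorem inner_minor (S : Matrix (Fin M) (Fin M) ℝ) (I : Finset (Fin M)) (u z : Vec M) :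
    inner ℝ u (minor S I z) = ∑ m ∈ I, ∑ l ∈ I, S m l * (u m * z l) := by
  simp only [inner_eq_sum, minor_apply, mul_ite, mul_zero, ← Finset.sum_filter,
    Finset.filter_univ_mem, Finset.mul_sum]
  exact Finset.sum_congr rfl fun m _ => Finset.sum_congr rfl fun l _ => by ring

theorem inner_minor_comm (hS : S.IsSymm) (I : Finset (Fin M)) (u z : Vec M) :
    inner ℝ u (minor S I z) = inner ℝ z (minor S I u) := by
  rw [inner_minor, inner_minor, Finset.sum_comm]
  exact Finset.sum_congr rfl fun m _ => Finset.sum_congr rfl fun l _ => by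
    rw [hS.apply]; ring

/-- The coordinate subspace `ℝ^I` of `ℝ^M`. -/
def coordSubspace (I : Finset (Fin M)) : Submodule ℝ (Vec M) where
  carrier := {u | ∀ m, m ∉ I → u m = 0}
  add_mem' := fun hu hz m hm => by simp [hu m hm, hz m hm]
  zero_mem' := fun m _ => by simp
  smul_mem' := fun c u hu m hm => by simp [hu m hm]

theorem mem_coordSubspace {u : Vec M} : u ∈ coordSubspace I ↔ ∀ m, m ∉ I → u m = 0 := Iff.rfl

theorem minor_mem_coordSubspace (u : Vec M) : minor S I u ∈ coordSubspace I := fun m hm => by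
  simp [minor_apply, hm]

/-- A vector attaining the minimum of the Rayleigh quotient on `ℝ^I` is an eigenvector. -/
theorem minor_eq_smul_of_minimizes (hS : S.IsSymm) {μ : ℝ}
    (hμ : ∀ z ∈ coordSubspace I, μ * inner ℝ z z ≤ inner ℝ z (minor S I z))
    {u : Vec M} (hu : u ∈ coordSubspace I) (hmin : inner ℝ u (minor S I u) = μ * inner ℝ u u) :
    minor S I u = μ • u := by
  set d : Vec M := minor S I u - μ • u with hd
  have hdI : d ∈ coordSubspace I :=
    Submodule.sub_mem _ (minor_mem_coordSubspace u) (Submodule.smul_mem _ _ hu)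
  set D : ℝ := inner ℝ d (minor S I d) - μ * inner ℝ d d with hD
  -- First variation along the residual `d`. Without a constant term, nonnegativity forces the
  -- discriminant `(2 * ⟨d, d⟩) ^ 2` to vanish.
  have key : ∀ ε : ℝ, 0 ≤ D * (ε * ε) + (2 * inner ℝ d d) * ε + 0 := by
    intro ε
    have h := hμ (u + ε • d) (Submodule.add_mem _ hu (Submodule.smul_mem _ _ hdI))
    simp only [map_add, map_smul, inner_add_left, inner_add_right, inner_smul_left,
      inner_smul_right, conj_trivial, hmin, inner_minor_comm hS I u d] at h
    have h1 : inner ℝ d d = inner ℝ d (minor S I u) - μ * inner ℝ d u := by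
      conv_lhs => rw [hd]
      rw [← hd, inner_sub_right, inner_smul_right]
    have h2 := real_inner_comm u d
    rw [hD]
    have h3 : inner ℝ d (minor S I u) = inner ℝ d d + μ * inner ℝ d u := by linarith
    rw [h3, h2] at h
    nlinarith [h]
  have h := discrim_le_zero key
  have h0 : inner ℝ d d = (0 : ℝ) := by
    simp only [discrim] at h
    nlinarith [sq_nonneg (inner ℝ d d : ℝ)]
  exact sub_eq_zero.1 (inner_self_eq_zero.1 h0)

/-- The vector of absolute values of the coordinates. -/
def coordAbs (u : Vec M) : Vec M := WithLp.toLp 2 fun m => |u m|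

@[simp] theorem coordAbs_apply (u : Vec M) (m : Fin M) : coordAbs u m = |u m| := rfl

theorem inner_coordAbs (u : Vec M) : inner ℝ (coordAbs u) (coordAbs u) = (inner ℝ u u : ℝ) := by
  rw [inner_eq_sum, inner_eq_sum]
  simp

theorem coordAbs_mem {u : Vec M} (hu : u ∈ coordSubspace I) : coordAbs u ∈ coordSubspace I :=
  fun m hm => by simp [mem_coordSubspace.1 hu m hm]

/-- Diagonal terms do not see signs; off-diagonal products only grow and have negative coefficients.
-/
theorem inner_minor_coordAbs_le (hneg : ∀ m l, m ≠ l → S m l < 0) (u : Vec M) :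
    inner ℝ (coordAbs u) (minor S I (coordAbs u)) ≤ inner ℝ u (minor S I u) := by
  rw [inner_minor, inner_minor]
  refine Finset.sum_le_sum fun m _ => Finset.sum_le_sum fun l _ => ?_
  simp only [coordAbs_apply, ← abs_mul]
  by_cases h : m = l
  · subst h
    rw [abs_mul_self]
  · exact mul_le_mul_of_nonpos_left (le_abs_self _) (hneg m l h).le

/-- A nonnegative eigenvector on `ℝ^I` with a vanishing coordinate in `I` is zero. -/
theorem eq_zero_of_minor_eq_smul_of_nonneg (hneg : ∀ m l, m ≠ l → S m l < 0) {μ : ℝ} {u : Vec M}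
    (hu : u ∈ coordSubspace I) (hnn : ∀ m, 0 ≤ u m) (h : minor S I u = μ • u) {m : Fin M}
    (hm : m ∈ I) (hum : u m = 0) : u = 0 := by
  -- Row `m` of the eigenvalue equation is a vanishing sum of nonpositive terms, and every
  -- off-diagonal coefficient in it is strictly negative.
  have h1 : ∑ l ∈ I, S m l * u l = 0 := by
    have := congrArg (fun z : Vec M => z m) h
    simpa [minor_apply, hm, hum] using this
  have hle : ∀ l ∈ I, S m l * u l ≤ 0 := fun l _ => by
    by_cases hl : m = l
    · rw [← hl, hum, mul_zero]
    · exact mul_nonpos_of_nonpos_of_nonneg (hneg m l hl).le (hnn l)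
  have h2 := (Finset.sum_eq_zero_iff_of_nonpos hle).1 h1
  ext l
  by_cases hl : l ∈ I
  · by_cases hml : m = l
    · simpa [← hml] using hum
    · simpa [(hneg m l hml).ne] using h2 l hl
  · simpa using mem_coordSubspace.1 hu l hl

/-- Absolute values keep the norm and do not raise the form, so they turn a minimizer into a
minimizer. -/
theorem minor_coordAbs_eq_smul (hS : S.IsSymm) (hneg : ∀ m l, m ≠ l → S m l < 0) {μ : ℝ}
    (hμ : ∀ z ∈ coordSubspace I, μ * inner ℝ z z ≤ inner ℝ z (minor S I z))
    {u : Vec M} (hu : u ∈ coordSubspace I) (h : minor S I u = μ • u) :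
    minor S I (coordAbs u) = μ • coordAbs u := by
  refine minor_eq_smul_of_minimizes hS hμ (coordAbs_mem hu) (le_antisymm ?_ (hμ _ (coordAbs_mem hu)))
  refine (inner_minor_coordAbs_le hneg u).trans_eq ?_
  rw [h, inner_smul_right, inner_coordAbs]

theorem eq_zero_of_minor_eq_smul (hS : S.IsSymm) (hneg : ∀ m l, m ≠ l → S m l < 0) {μ : ℝ}
    (hμ : ∀ z ∈ coordSubspace I, μ * inner ℝ z z ≤ inner ℝ z (minor S I z))
    {u : Vec M} (hu : u ∈ coordSubspace I) (h : minor S I u = μ • u) {m : Fin M}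
    (hm : m ∈ I) (hum : u m = 0) : u = 0 := by
  have := eq_zero_of_minor_eq_smul_of_nonneg hneg (coordAbs_mem hu) (fun m => abs_nonneg _)
    (minor_coordAbs_eq_smul hS hneg hμ hu h) hm (by simp [hum])
  ext l
  simpa using congrArg (fun z : Vec M => z l) this

/-- Perron's theorem for the least eigenvalue of a principal minor. -/
theorem exists_perron (hS : S.IsSymm) (hneg : ∀ m l, m ≠ l → S m l < 0) (hI : I.Nonempty) :
    ∃ (μ : ℝ) (p : Vec M), p ∈ coordSubspace I ∧ (∀ m ∈ I, 0 < p m) ∧ minor S I p = μ • p ∧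
      (∀ z ∈ coordSubspace I, μ * inner ℝ z z ≤ inner ℝ z (minor S I z)) ∧
      ∀ u ∈ coordSubspace I, minor S I u = μ • u → ∃ c : ℝ, u = c • p := by
  obtain ⟨m₀, hm₀⟩ := hI
  have hK : IsCompact (Metric.sphere (0 : Vec M) 1 ∩ coordSubspace I) :=
    (isCompact_sphere _ _).inter_right (coordSubspace I).closed_of_finiteDimensional
  have hne : (Metric.sphere (0 : Vec M) 1 ∩ coordSubspace I).Nonempty :=
    ⟨EuclideanSpace.single m₀ 1, by simp, fun m hm => by
      have : m ≠ m₀ := fun h => hm (h ▸ hm₀)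
      simp [this]⟩
  obtain ⟨q, ⟨hq1, hqI⟩, hqmin⟩ := hK.exists_isMinOn hne
    (f := fun z => inner ℝ z (minor S I z)) (by fun_prop)
  have hq1 : ‖q‖ = 1 := by simpa using hq1
  set μ : ℝ := inner ℝ q (minor S I q) with hμdef
  have hμ : ∀ z ∈ coordSubspace I, μ * inner ℝ z z ≤ inner ℝ z (minor S I z) := by
    intro z hz
    by_cases hz0 : z = 0
    · simp [hz0]
    have hzn : 0 < ‖z‖ := norm_pos_iff.2 hz0
    have := isMinOn_iff.1 hqmin (‖z‖⁻¹ • z)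
      ⟨by simp [norm_smul, hzn.ne'], Submodule.smul_mem _ _ hz⟩
    simp only [map_smul, inner_smul_left, inner_smul_right, conj_trivial] at this
    rw [real_inner_self_eq_norm_sq]
    have h2 : ‖z‖⁻¹ * (‖z‖⁻¹ * inner ℝ z (minor S I z)) * ‖z‖ ^ 2 = inner ℝ z (minor S I z) := by
      field_simp
    rw [← h2]
    exact mul_le_mul_of_nonneg_right this (by positivity)
  have hqe : minor S I q = μ • q :=
    minor_eq_smul_of_minimizes hS hμ hqI (by rw [real_inner_self_eq_norm_sq, hq1]; simp [hμdef])
  have hpe := minor_coordAbs_eq_smul hS hneg hμ hqI hqe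
  have hpos : ∀ m ∈ I, 0 < coordAbs q m := fun m hm => by
    refine lt_of_le_of_ne (abs_nonneg _) fun h => ?_
    have h0 : q = 0 := eq_zero_of_minor_eq_smul hS hneg hμ hqI hqe hm
      (abs_eq_zero.1 h.symm)
    simp [h0] at hq1
  refine ⟨μ, coordAbs q, coordAbs_mem hqI, hpos, hpe, hμ, fun u hu hue => ?_⟩
  -- With this factor the difference is an eigenvector vanishing at `m₀`, hence zero.
  refine ⟨u m₀ / coordAbs q m₀, ?_⟩
  refine sub_eq_zero.1 (eq_zero_of_minor_eq_smul hS hneg hμ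
    (Submodule.sub_mem _ hu (Submodule.smul_mem _ _ (coordAbs_mem hqI))) ?_ hm₀ ?_)
  · rw [map_sub, map_smul, hue, hpe, smul_sub, smul_comm]
  · have := (hpos m₀ hm₀).ne'
    simp only [PiLp.sub_apply, PiLp.smul_apply, smul_eq_mul]
    field_simp
    ring

/-! ### The gated flow on the unit sphere -/

/-- The set of positive coordinates of `u`. -/
def posSupport (u : Vec M) : Finset (Fin M) := Finset.univ.filter fun m => 0 < u m

@[simp] theorem mem_posSupport {u : Vec M} {m : Fin M} : m ∈ posSupport u ↔ 0 < u m := by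
  simp [posSupport]

theorem mem_coordSubspace_posSupport {u : Vec M} (hu : ∀ m, 0 ≤ u m) :
    u ∈ coordSubspace (posSupport u) := fun m hm =>
  le_antisymm (not_lt.1 fun h => hm (mem_posSupport.2 h)) (hu m)

theorem posSupport_eq {u : Vec M} (hu : u ∈ coordSubspace I) (hpos : ∀ m ∈ I, 0 < u m) :
    posSupport u = I := by
  ext m
  rw [mem_posSupport]
  refine ⟨fun h => ?_, hpos m⟩
  by_contra hm
  exact h.ne' (hu m hm)

theorem posSupport_nonempty {u : Vec M} (hu : ∀ m, 0 ≤ u m) (h1 : ‖u‖ = 1) :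
    (posSupport u).Nonempty := by
  by_contra h
  rw [Finset.not_nonempty_iff_eq_empty] at h
  have : u = 0 := by
    ext m
    exact mem_coordSubspace_posSupport hu m (by simp [h])
  simp [this] at h1

theorem eq_single_of_posSupport {u : Vec M} (hu : ∀ m, 0 ≤ u m) (h1 : ‖u‖ = 1) {m : Fin M}
    (hm : posSupport u = {m}) : u = EuclideanSpace.single m 1 := by
  have h0 : ∀ l, l ≠ m → u l = 0 := fun l hl =>
    mem_coordSubspace_posSupport hu l (by simpa [hm] using hl)
  have hum : u = EuclideanSpace.single m (u m) := by
    ext l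
    by_cases h : l = m
    · simp [h]
    · simp [h, h0 l h]
  have : ‖u m‖ = 1 := by
    rw [hum] at h1
    simpa using h1
  rw [Real.norm_eq_abs, abs_of_nonneg (hu m)] at this
  rw [hum, this]

/-- Curves on the unit sphere whose right derivative is the tangential part of the quadratic
field of `S`, restricted to the positive coordinates. -/
structure IsFlow (S : Matrix (Fin M) (Fin M) ℝ) (u : ℝ → Vec M) : Prop where
  continuousOn : ContinuousOn u (Set.Ici 0)
  norm_eq : ∀ t, 0 ≤ t → ‖u t‖ = 1
  hasDeriv : ∀ t, 0 ≤ t →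
    HasDerivWithinAt u (tangent (u t) (minor S (posSupport (u t)) (u t))) (Set.Ici t) t

theorem hasDerivWithinAt_add_right {E : Type*} [NormedAddCommGroup E] [NormedSpace ℝ E]
    {f : ℝ → E} {f' : E} {t : ℝ} (a : ℝ) (h : HasDerivWithinAt f f' (Set.Ici (t + a)) (t + a)) :
    HasDerivWithinAt (fun s => f (s + a)) f' (Set.Ici t) t := by
  have := HasDerivWithinAt.scomp (h := fun s : ℝ => s + a) (h' := 1) (s := Set.Ici t) t h
    ((hasDerivWithinAt_id t _).add_const a) (fun s hs => by
      simp only [Set.mem_Ici] at hs ⊢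
      linarith)
  simpa using! this

/-! ### Invariance of the orthant and irreversible loss of coordinates -/

namespace IsFlow
variable {u : ℝ → Vec M}

theorem shift (hu : IsFlow S u) {a : ℝ} (ha : 0 ≤ a) : IsFlow S fun t => u (t + a) where
  continuousOn := hu.continuousOn.comp (by fun_prop) fun t ht => by
    simp only [Set.mem_Ici] at ht ⊢
    linarith
  norm_eq t ht := hu.norm_eq _ (by linarith)
  hasDeriv t ht := hasDerivWithinAt_add_right a (hu.hasDeriv (t + a) (by linarith))

theorem continuousOn_Icc (hu : IsFlow S u) {a b : ℝ} (ha : 0 ≤ a) :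
    ContinuousOn u (Set.Icc a b) :=
  hu.continuousOn.mono fun _ ht => ha.trans ht.1

theorem continuousOn_coord (hu : IsFlow S u) (m : Fin M) :
    ContinuousOn (fun t => u t m) (Set.Ici 0) :=
  (EuclideanSpace.proj (𝕜 := ℝ) m).continuous.comp_continuousOn hu.continuousOn

theorem hasDeriv_coord (hu : IsFlow S u) {t : ℝ} (ht : 0 ≤ t) (m : Fin M) :
    HasDerivWithinAt (fun t => u t m)
      ((if 0 < u t m then ∑ l ∈ posSupport (u t), S m l * u t l else 0)
        - inner ℝ (u t) (minor S (posSupport (u t)) (u t)) * u t m) (Set.Ici t) t := by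
  have := (EuclideanSpace.proj (𝕜 := ℝ) m).hasFDerivAt.comp_hasDerivWithinAt t (hu.hasDeriv t ht)
  simpa [tangent, minor_apply] using! this

/-- The Rayleigh quotients of all principal minors are bounded. -/
theorem _root_.OneHidReLU.exists_abs_inner_minor_le (S : Matrix (Fin M) (Fin M) ℝ) :
    ∃ C : ℝ, ∀ (I : Finset (Fin M)) (u : Vec M), ‖u‖ = 1 → |inner ℝ u (minor S I u)| ≤ C := by
  refine ⟨∑ I, ‖minor S I‖, fun I u hu => ?_⟩
  calc |inner ℝ u (minor S I u)| ≤ ‖u‖ * ‖minor S I u‖ := abs_real_inner_le_norm _ _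
    _ ≤ ‖u‖ * (‖minor S I‖ * ‖u‖) := by gcongr; exact (minor S I).le_opNorm u
    _ = ‖minor S I‖ := by rw [hu]; ring
    _ ≤ _ := Finset.single_le_sum (f := fun I => ‖minor S I‖) (fun _ _ => norm_nonneg _)
      (Finset.mem_univ I)

/-- Where the coordinate is not positive its gate is closed and only the normalisation term, linear
in the coordinate, remains. -/
theorem nonneg (hu : IsFlow S u) {m : Fin M} (h0 : 0 ≤ u 0 m) {t : ℝ} (ht : 0 ≤ t) :
    0 ≤ u t m := by
  obtain ⟨C, hC⟩ := exists_abs_inner_minor_le S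
  have := nonpos_of_deriv_right_le (f := fun t => -u t m) (K := C) ht
    ((hu.continuousOn_coord m).neg.mono fun _ hs => hs.1)
    (fun s hs => (hu.hasDeriv_coord hs.1 m).neg) (fun s hs hf => ?_) (by simpa using h0)
  · simpa using this
  · have hn : ¬ 0 < u s m := by simpa using hf
    have h1 := (neg_le_of_abs_le (hC (posSupport (u s)) (u s) (hu.norm_eq s hs.1)))
    rw [if_neg hn]
    nlinarith

/-- The other positive coordinates only push this one down, so it grows at most exponentially and
cannot leave zero upwards. -/
theorem nonpos (hneg : ∀ m l, m ≠ l → S m l < 0) (hu : IsFlow S u) {m : Fin M} {a b : ℝ}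
    (ha : 0 ≤ a) (hab : a ≤ b) (h0 : u a m ≤ 0) : u b m ≤ 0 := by
  obtain ⟨C, hC⟩ := exists_abs_inner_minor_le S
  refine nonpos_of_deriv_right_le (f := fun t => u t m) (K := |S m m| + C) hab
    ((hu.continuousOn_coord m).mono fun _ hs => ha.trans hs.1)
    (fun s hs => (hu.hasDeriv_coord (ha.trans hs.1) m)) (fun s hs hf => ?_) h0
  have h1 := (neg_le_of_abs_le (hC (posSupport (u s)) (u s) (hu.norm_eq s (ha.trans hs.1))))
  have h2 : (if 0 < u s m then ∑ l ∈ posSupport (u s), S m l * u s l else 0)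
      ≤ |S m m| * u s m := by
    split_ifs with h
    · rw [← Finset.add_sum_erase _ _ (mem_posSupport.2 h)]
      have : ∑ l ∈ (posSupport (u s)).erase m, S m l * u s l ≤ 0 :=
        Finset.sum_nonpos fun l hl => mul_nonpos_of_nonpos_of_nonneg
          (hneg m l (Finset.ne_of_mem_erase hl).symm).le
          (mem_posSupport.1 (Finset.mem_of_mem_erase hl)).le
      have := mul_le_mul_of_nonneg_right (le_abs_self (S m m)) h.le
      linarith
    · positivity
  nlinarith

theorem posSupport_subset (hneg : ∀ m l, m ≠ l → S m l < 0) (hu : IsFlow S u) {a b : ℝ}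
    (ha : 0 ≤ a) (hab : a ≤ b) : posSupport (u b) ⊆ posSupport (u a) := fun m hm => by
  rw [mem_posSupport] at hm ⊢
  by_contra! h
  exact (hu.nonpos hneg ha hab h).not_gt hm

end IsFlow

/-- The first time at which one of the coordinates in `I` stops being positive. -/
theorem forall_pos_or_exists_first_exit {u : ℝ → Vec M}
    (hu : ContinuousOn u (Set.Ici 0)) (I : Finset (Fin M)) :
    (∀ t, 0 ≤ t → ∀ m ∈ I, 0 < u t m) ∨
      ∃ T, 0 ≤ T ∧ (∀ t ∈ Set.Ico 0 T, ∀ m ∈ I, 0 < u t m) ∧ ∃ m ∈ I, u T m ≤ 0 := by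
  by_cases h : ∀ t, 0 ≤ t → ∀ m ∈ I, 0 < u t m
  · exact Or.inl h
  right
  set K : Set ℝ := ⋃ m ∈ I, Set.Ici 0 ∩ (fun t => u t m) ⁻¹' Set.Iic 0 with hK
  have hmem : ∀ t, t ∈ K ↔ 0 ≤ t ∧ ∃ m ∈ I, u t m ≤ 0 := fun t => by
    simp only [hK, Set.mem_iUnion, Set.mem_inter_iff, Set.mem_Ici, Set.mem_preimage, Set.mem_Iic]
    tauto
  have hcl : IsClosed K := I.finite_toSet.isClosed_biUnion fun m _ =>
    ((EuclideanSpace.proj (𝕜 := ℝ) m).continuous.comp_continuousOn hu).preimage_isClosed_of_isClosed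
      isClosed_Ici isClosed_Iic
  have hne : K.Nonempty := by
    push Not at h
    obtain ⟨t, ht, m, hm, h⟩ := h
    exact ⟨t, (hmem t).2 ⟨ht, m, hm, h⟩⟩
  have hbdd : BddBelow K := ⟨0, fun t ht => ((hmem t).1 ht).1⟩
  obtain ⟨hT0, hT⟩ := (hmem _).1 (hcl.csInf_mem hne hbdd)
  refine ⟨sInf K, hT0, fun t ht m hm => ?_, hT⟩
  by_contra! h'
  exact (csInf_le hbdd ((hmem t).2 ⟨ht.1, m, hm, h'⟩)).not_gt ht.2

/-! ### Rest at the Perron vector or loss of a coordinate -/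

namespace IsFlow
variable {u : ℝ → Vec M}

theorem posSupport_const_or_exit (hneg : ∀ m l, m ≠ l → S m l < 0) (hu : IsFlow S u) :
    (∀ t, 0 ≤ t → posSupport (u t) = posSupport (u 0)) ∨
      ∃ T, 0 ≤ T ∧ (∀ t ∈ Set.Ico 0 T, posSupport (u t) = posSupport (u 0)) ∧
        posSupport (u T) ⊂ posSupport (u 0) := by
  rcases forall_pos_or_exists_first_exit hu.continuousOn (posSupport (u 0)) with
    h | ⟨T, hT, h, m, hm, hmT⟩
  · exact Or.inl fun t ht => (hu.posSupport_subset hneg le_rfl ht).antisymm fun m hm =>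
      mem_posSupport.2 (h t ht m hm)
  · refine Or.inr ⟨T, hT, fun t ht => (hu.posSupport_subset hneg le_rfl ht.1).antisymm
      fun m hm => mem_posSupport.2 (h t ht m hm), ?_⟩
    exact (Finset.ssubset_iff_of_subset (hu.posSupport_subset hneg le_rfl hT)).2
      ⟨m, hm, by simpa using hmT⟩

/-- A flow line that never loses a coordinate rests at the Perron vector. -/
theorem rest_of_posSupport_const (hS : S.IsSymm) {μ : ℝ} {p : Vec M}
    (hppos : ∀ m ∈ I, 0 < p m) (hpe : minor S I p = μ • p)
    (hμ : ∀ z ∈ coordSubspace I, μ * inner ℝ z z ≤ inner ℝ z (minor S I z))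
    (hu : IsFlow S u) (hnn : ∀ m, 0 ≤ u 0 m) (hI : I.Nonempty)
    (hconst : ∀ t, 0 ≤ t → posSupport (u t) = I) :
    minor S I (u 0) = μ • u 0 ∧ ∀ t, 0 ≤ t → u t = u 0 := by
  have huI : ∀ t, 0 ≤ t → u t ∈ coordSubspace I := fun t ht => by
    have := mem_coordSubspace_posSupport fun m => hu.nonneg (hnn m) ht
    rwa [hconst t ht] at this
  have hder : ∀ t, 0 ≤ t →
      HasDerivWithinAt u (tangent (u t) (minor S I (u t))) (Set.Ici t) t := fun t ht => by
    have := hu.hasDeriv t ht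
    rwa [hconst t ht] at this
  set lam : ℝ → ℝ := fun t => inner ℝ (u t) (minor S I (u t)) with hlam
  have hself : ∀ t, 0 ≤ t → inner ℝ (u t) (u t) = (1 : ℝ) := fun t ht => by
    rw [real_inner_self_eq_norm_sq, hu.norm_eq t ht, one_pow]
  have hlamcont : ContinuousOn lam (Set.Ici 0) :=
    hu.continuousOn.inner ((minor S I).continuous.comp_continuousOn hu.continuousOn)
  -- With `A = minor S I`, the right derivative of `lam` is `2 * (‖A u‖ ^ 2 - lam ^ 2)`, nonnegative
  -- by Cauchy–Schwarz.
  have hlammono : ∀ a b, 0 ≤ a → a ≤ b → lam a ≤ lam b := by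
    intro a b ha hab
    have := le_of_deriv_right_le (f := fun t => -lam t) (C := 0) hab
      (hlamcont.neg.mono fun _ hs => ha.trans hs.1)
      (fun t ht => ((hder t (ha.trans ht.1)).inner ℝ
        ((minor S I).hasFDerivAt.comp_hasDerivWithinAt t (hder t (ha.trans ht.1)))).neg)
      (fun t ht => by
        have h1 := real_inner_mul_inner_self_le (u t) (minor S I (u t))
        rw [inner_minor_comm hS]
        simp only [tangent, inner_sub_left, inner_smul_left, conj_trivial, Function.comp_apply]
        rw [hself t (ha.trans ht.1)] at h1
        nlinarith)
    simp at this
    linarith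
  -- Take `κ` to be the least `p m` with `m ∈ I`: the coordinates of `u` lie in `[0, 1]`, so each
  -- dominates its square, and the squares sum to `1`.
  obtain ⟨κ, hκ, hκp⟩ : ∃ κ : ℝ, 0 < κ ∧ ∀ t, 0 ≤ t → κ ≤ inner ℝ p (u t) := by
    obtain ⟨m₀, hm₀, hmin⟩ := I.exists_min_image (fun m => p m) hI
    refine ⟨p m₀, hppos m₀ hm₀, fun t ht => ?_⟩
    have hut := fun m => hu.nonneg (hnn m) ht
    have hle1 : ∀ m, u t m ≤ 1 := fun m => by
      have := PiLp.norm_apply_le (u t) m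
      rw [hu.norm_eq t ht] at this
      exact (le_abs_self _).trans this
    calc p m₀ = p m₀ * ∑ m, u t m * u t m := by rw [← inner_eq_sum, hself t ht, mul_one]
      _ = ∑ m, p m₀ * (u t m * u t m) := Finset.mul_sum _ _ _
      _ ≤ ∑ m, p m * u t m := Finset.sum_le_sum fun m _ => by
        by_cases hm : m ∈ I
        · have h1 := hmin m hm
          have h2 : u t m * u t m ≤ u t m := by nlinarith [hut m, hle1 m]
          exact mul_le_mul h1 h2 (mul_nonneg (hut m) (hut m)) (hppos m hm).le
        · simp [mem_coordSubspace.1 (huI t ht) m hm]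
      _ = inner ℝ p (u t) := (inner_eq_sum _ _).symm
  have hle : ∀ t, 0 ≤ t → lam t ≤ μ := by
    intro t₀ ht₀
    by_contra! hlt
    set δ := lam t₀ - μ with hδ
    have hδ0 : 0 < δ := by linarith
    have hq : ∀ t, t₀ ≤ t → inner ℝ p (u t) ≤ inner ℝ p (u t₀) + -(δ * κ) * (t - t₀) := by
      intro t ht
      refine le_of_deriv_right_le (f := fun t => inner ℝ p (u t)) ht
        ((continuousOn_const.inner hu.continuousOn).mono fun _ hs => ht₀.trans hs.1)
        (fun s hs => (hasDerivWithinAt_const s _ p).inner ℝ (hder s (ht₀.trans hs.1)))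
        (fun s hs => ?_)
      have hs0 := ht₀.trans hs.1
      simp only [tangent, inner_sub_right, inner_smul_right, inner_zero_left, add_zero]
      rw [inner_minor_comm hS, hpe, inner_smul_right, real_inner_comm p (u s)]
      have h1 := hlammono t₀ s ht₀ hs.1
      have h2 := hκp s hs0
      have h3 : δ * κ ≤ (lam s - μ) * inner ℝ p (u s) :=
        mul_le_mul (by linarith) h2 hκ.le (by linarith)
      simp only [hlam] at h3 ⊢
      linarith
    -- At this time the linear upper bound reaches zero, below `κ`.
    have h1 := hq (t₀ + inner ℝ p (u t₀) / (δ * κ))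
      (by have := (hκ.trans_le (hκp t₀ ht₀)).le; simp; positivity)
    have h2 := hκp (t₀ + inner ℝ p (u t₀) / (δ * κ))
      (by have := (hκ.trans_le (hκp t₀ ht₀)).le; positivity)
    have h3 : -(δ * κ) * (t₀ + inner ℝ p (u t₀) / (δ * κ) - t₀) = -inner ℝ p (u t₀) := by
      field_simp
      ring
    linarith
  have heig : ∀ t, 0 ≤ t → minor S I (u t) = μ • u t := fun t ht =>
    minor_eq_smul_of_minimizes hS hμ (huI t ht)
      (le_antisymm (by rw [hself t ht, mul_one]; exact hle t ht) (hμ _ (huI t ht)))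
  refine ⟨heig 0 le_rfl, fun t ht => ?_⟩
  refine constant_of_has_deriv_right_zero (hu.continuousOn_Icc le_rfl) (fun s hs => ?_) t
    (Set.right_mem_Icc.2 ht)
  have := hder s hs.1
  rwa [tangent, heig s hs.1, inner_smul_right, hself s hs.1, mul_one, sub_self] at this

theorem rest_or_exit (hS : S.IsSymm) (hneg : ∀ m l, m ≠ l → S m l < 0) (hu : IsFlow S u)
    (hnn : ∀ m, 0 ≤ u 0 m) :
    (∀ t, 0 ≤ t → u t = u 0) ∨
      ∃ T, 0 ≤ T ∧ (∀ t ∈ Set.Ico 0 T, posSupport (u t) = posSupport (u 0)) ∧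
        posSupport (u T) ⊂ posSupport (u 0) := by
  refine (hu.posSupport_const_or_exit hneg).imp_left fun h => ?_
  have hne := posSupport_nonempty hnn (hu.norm_eq 0 le_rfl)
  obtain ⟨μ, p, -, hpos, hpe, hμ, -⟩ := exists_perron hS hneg hne
  exact (hu.rest_of_posSupport_const hS hpos hpe hμ hnn hne h).2

/-- Every flow line converges to a coordinate vector or comes to rest at a mixed point. -/
theorem tendsto_single_or_rest (hS : S.IsSymm) (hneg : ∀ m l, m ≠ l → S m l < 0)
    (hu : IsFlow S u) (hnn : ∀ m, 0 ≤ u 0 m) :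
    (∃ m, Tendsto u atTop (𝓝 (EuclideanSpace.single m 1))) ∨
      ∃ T, 0 ≤ T ∧ (∀ t, T ≤ t → u t = u T) ∧
        ∃ m l, m ≠ l ∧ 0 < u T m ∧ 0 < u T l := by
  induction hI : posSupport (u 0) using Finset.strongInduction generalizing u with
  | H I ih =>
    rcases hu.rest_or_exit hS hneg hnn with h | ⟨T, hT, -, hlt⟩
    · rcases (posSupport_nonempty hnn (hu.norm_eq 0 le_rfl)).exists_eq_singleton_or_nontrivial with
        ⟨m, hm⟩ | ⟨m, hm, l, hl, hml⟩
      · refine Or.inl ⟨m, ?_⟩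
        rw [← eq_single_of_posSupport hnn (hu.norm_eq 0 le_rfl) hm]
        exact tendsto_const_nhds.congr' ((eventually_ge_atTop 0).mono fun t ht => (h t ht).symm)
      · exact Or.inr ⟨0, le_rfl, h, m, l, hml, mem_posSupport.1 hm, mem_posSupport.1 hl⟩
    · rcases ih _ (by rw [← hI]; exact hlt) (hu.shift hT)
        (fun m => by simpa using hu.nonneg (hnn m) hT) (by simp) with ⟨m, hm⟩ | ⟨T', hT', h, hml⟩
      · refine Or.inl ⟨m, ?_⟩
        have := hm.comp (tendsto_atTop_add_const_right atTop (-T) tendsto_id)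
        simpa [Function.comp_def] using this
      · refine Or.inr ⟨T' + T, by positivity, fun t ht => ?_, hml⟩
        simpa using h (t - T) (by linarith)

theorem _root_.OneHidReLU.exp_smul_apply_exp_neg_smul_apply {E : Type*} [NormedAddCommGroup E]
    [NormedSpace ℝ E] [CompleteSpace E] (A : E →L[ℝ] E) (t : ℝ) (z : E) :
    NormedSpace.exp (t • A) (NormedSpace.exp (t • -A) z) = z := by
  let _ : NormedAlgebra ℚ (E →L[ℝ] E) := NormedAlgebra.restrictScalars ℚ ℝ _
  have h : Commute (t • A) (t • -A) := by
    rw [smul_neg]; exact (Commute.refl _).neg_right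
  have := NormedSpace.exp_add_of_commute h
  rw [smul_neg, add_neg_cancel, NormedSpace.exp_zero, ← smul_neg] at this
  exact (congrArg (fun L : E →L[ℝ] E => L z) this).symm

/-- As long as no coordinate is lost, the flow is the normalised linear flow of the minor. -/
theorem eq_smul_exp_of_posSupport_const (hu : IsFlow S u) {T : ℝ} (hT : 0 ≤ T)
    (h : ∀ t ∈ Set.Ico 0 T, posSupport (u t) = I) :
    ∃ c : ℝ, u 0 = c • NormedSpace.exp (T • -minor S I) (u T) := by
  set A := minor S I with hA
  set y : ℝ → Vec M := fun t => NormedSpace.exp (t • -A) (u t) with hy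
  have hexp : ∀ t : ℝ, HasDerivAt (fun t : ℝ => NormedSpace.exp (t • -A))
      (NormedSpace.exp (t • -A) * -A) t := fun t => hasDerivAt_exp_smul_const (-A) t
  have hycont : ContinuousOn y (Set.Icc 0 T) :=
    ContinuousOn.clm_apply (fun t _ => (hexp t).continuousAt.continuousWithinAt)
      (hu.continuousOn_Icc le_rfl)
  have hyder : ∀ t ∈ Set.Ico 0 T,
      HasDerivWithinAt y (-inner ℝ (u t) (A (u t)) • y t) (Set.Ici t) t := fun t ht => by
    have h1 := (hexp t).hasDerivWithinAt.clm_apply (hu.hasDeriv t ht.1)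
    rw [h t ht] at h1
    refine h1.congr_deriv ?_
    simp [tangent, hy, hA]
    abel
  -- Since `y' = -λ y`, the curve `y` should stay on the line through `u 0`. The projection `L` has
  -- this line as kernel, and Grönwall with initial value zero gives `L (y T) = 0`.
  set L : Vec M →L[ℝ] Vec M :=
    ContinuousLinearMap.id ℝ _ - (innerSL ℝ (u 0)).smulRight (u 0) with hL
  have hLapp : ∀ z, L z = z - inner ℝ (u 0) z • u 0 := fun z => by simp [hL]
  obtain ⟨C, hC⟩ := exists_abs_inner_minor_le S
  have hy0 : y 0 = u 0 := by simp [hy]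
  have hz := norm_le_gronwallBound_of_norm_deriv_right_le (f := fun t => L (y t)) (δ := 0) (K := C)
    (ε := 0) (L.continuous.comp_continuousOn hycont)
    (fun t ht => L.hasFDerivAt.comp_hasDerivWithinAt t (hyder t ht))
    (by simp [hLapp, hy0, hu.norm_eq 0 le_rfl])
    (fun t ht => by
      rw [map_smul, norm_smul, Real.norm_eq_abs, abs_neg, add_zero]
      exact mul_le_mul_of_nonneg_right (hC I _ (hu.norm_eq t ht.1)) (norm_nonneg _))
    T (Set.right_mem_Icc.2 hT)
  simp only [gronwallBound_ε0_δ0, norm_le_zero_iff, hLapp, sub_eq_zero] at hz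
  -- Otherwise `y T = 0`, and invertibility of the exponential would give `u T = 0`.
  have hne : (inner ℝ (u 0) (y T) : ℝ) ≠ 0 := fun h0 => by
    rw [h0, zero_smul] at hz
    have h1 := exp_smul_apply_exp_neg_smul_apply A T (u T)
    simp only [hy] at hz
    rw [hz, map_zero] at h1
    have := hu.norm_eq T hT
    simp [← h1] at this
  refine ⟨(inner ℝ (u 0) (y T))⁻¹, ?_⟩
  change u 0 = (inner ℝ (u 0) (y T))⁻¹ • y T
  rw [eq_inv_smul_iff₀ hne]
  exact hz.symm

end IsFlow

/-! ### Existence of the gated flow -/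

/-- The normalised linear flow of a principal minor. -/
def linearFlow (S : Matrix (Fin M) (Fin M) ℝ) (I : Finset (Fin M)) (u₀ : Vec M) (t : ℝ) : Vec M :=
  ‖NormedSpace.exp (t • minor S I) u₀‖⁻¹ • NormedSpace.exp (t • minor S I) u₀

theorem exp_smul_apply_ne_zero {E : Type*} [NormedAddCommGroup E] [NormedSpace ℝ E]
    [CompleteSpace E] (A : E →L[ℝ] E) (t : ℝ) {z : E} (hz : z ≠ 0) :
    NormedSpace.exp (t • A) z ≠ 0 := fun h => hz <| by
  have := exp_smul_apply_exp_neg_smul_apply (-A) t z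
  rw [neg_neg, h, map_zero] at this
  exact this.symm

theorem hasDerivAt_exp_smul_apply {E : Type*} [NormedAddCommGroup E] [NormedSpace ℝ E]
    [CompleteSpace E] (A : E →L[ℝ] E) (z : E) (t : ℝ) :
    HasDerivAt (fun t : ℝ => NormedSpace.exp (t • A) z) (A (NormedSpace.exp (t • A) z)) t := by
  simpa using (hasDerivAt_exp_smul_const' A t).clm_apply (hasDerivAt_const t z)

theorem norm_linearFlow {u₀ : Vec M} (h : u₀ ≠ 0) (t : ℝ) : ‖linearFlow S I u₀ t‖ = 1 := by
  have := norm_ne_zero_iff.2 (exp_smul_apply_ne_zero (minor S I) t h)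
  rw [linearFlow, norm_smul, norm_inv, norm_norm, inv_mul_cancel₀ this]

theorem linearFlow_zero {u₀ : Vec M} (h : ‖u₀‖ = 1) : linearFlow S I u₀ 0 = u₀ := by
  have h0 : (0 : ℝ) • minor S I = 0 := by ext; simp
  simp [linearFlow, h, h0]

theorem hasDerivAt_linearFlow {u₀ : Vec M} (h : u₀ ≠ 0) (t : ℝ) :
    HasDerivAt (linearFlow S I u₀)
      (tangent (linearFlow S I u₀ t) (minor S I (linearFlow S I u₀ t))) t := by
  set y : ℝ → Vec M := fun t => NormedSpace.exp (t • minor S I) u₀ with hy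
  have hder : HasDerivAt y (minor S I (y t)) t := hasDerivAt_exp_smul_apply _ _ _
  have hne : ‖y t‖ ≠ 0 := norm_ne_zero_iff.2 (exp_smul_apply_ne_zero (minor S I) t h)
  have hn : HasDerivAt (fun t => ‖y t‖) (inner ℝ (y t) (minor S I (y t)) / ‖y t‖) t := by
    have := hder.norm_sq.sqrt (pow_ne_zero 2 hne)
    simp only [Real.sqrt_sq (norm_nonneg _)] at this
    refine this.congr_deriv ?_
    field_simp
  have := (hn.fun_inv hne).smul hder
  refine this.congr_deriv ?_
  change _ = tangent (‖y t‖⁻¹ • y t) (minor S I (‖y t‖⁻¹ • y t))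
  simp only [tangent, map_smul, inner_smul_left, inner_smul_right, conj_trivial, smul_smul]
  rw [sub_eq_add_neg, ← neg_smul]
  congr 2
  field_simp

theorem linearFlow_mem {u₀ : Vec M} (h : u₀ ∈ coordSubspace I) (t : ℝ) :
    linearFlow S I u₀ t ∈ coordSubspace I := by
  refine Submodule.smul_mem _ _ fun m hm => ?_
  have hd : ∀ s, HasDerivAt (fun s : ℝ => NormedSpace.exp (s • minor S I) u₀ m) 0 s := fun s => by
    have := (EuclideanSpace.proj (𝕜 := ℝ) m).hasFDerivAt.comp_hasDerivAt s
      (hasDerivAt_exp_smul_apply (minor S I) u₀ s)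
    have h0 : minor S I (NormedSpace.exp (s • minor S I) u₀) m = 0 :=
      minor_mem_coordSubspace _ m hm
    exact this.congr_deriv h0
  have := is_const_of_deriv_eq_zero (fun s => (hd s).differentiableAt) (fun s => (hd s).deriv) t 0
  have h0 : (0 : ℝ) • minor S I = 0 := by ext; simp
  simpa [h0, mem_coordSubspace.1 h m hm] using this

theorem exists_isFlow (S : Matrix (Fin M) (Fin M) ℝ) {u₀ : Vec M} (h1 : ‖u₀‖ = 1)
    (hnn : ∀ m, 0 ≤ u₀ m) : ∃ u, IsFlow S u ∧ u 0 = u₀ := by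
  induction hI : posSupport u₀ using Finset.strongInduction generalizing u₀ with
  | H I ih =>
    have hne : u₀ ≠ 0 := fun h => by simp [h] at h1
    have huI : u₀ ∈ coordSubspace I := hI ▸ mem_coordSubspace_posSupport hnn
    set n := linearFlow S I u₀ with hn
    have hcont : Continuous n :=
      continuous_iff_continuousAt.2 fun t => (hasDerivAt_linearFlow hne t).continuousAt
    have hder : ∀ t, (∀ m ∈ I, 0 < n t m) →
        HasDerivAt n (tangent (n t) (minor S (posSupport (n t)) (n t))) t := fun t ht => by
      rw [posSupport_eq (linearFlow_mem huI t) ht]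
      exact hasDerivAt_linearFlow hne t
    rcases forall_pos_or_exists_first_exit hcont.continuousOn I with h | ⟨T, hT, h, m₀, hm₀, hT₀⟩
    · exact ⟨n, ⟨hcont.continuousOn, fun t _ => norm_linearFlow hne t,
        fun t ht => (hder t (h t ht)).hasDerivWithinAt⟩, linearFlow_zero h1⟩
    have hTpos : T ≠ 0 := fun h0 => by
      rw [h0, hn, linearFlow_zero h1] at hT₀
      rw [← hI, mem_posSupport] at hm₀
      exact hT₀.not_gt hm₀
    have hnT : ∀ m, 0 ≤ n T m := fun m => by
      by_cases hm : m ∈ I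
      · have hcl : IsClosed {t | 0 ≤ n t m} :=
          isClosed_le continuous_const ((EuclideanSpace.proj (𝕜 := ℝ) m).continuous.comp hcont)
        have hsub : closure (Set.Ico 0 T) ⊆ {t | 0 ≤ n t m} :=
          closure_minimal (fun t ht => (h t ht m hm).le) hcl
        rw [closure_Ico hTpos.symm] at hsub
        exact hsub (Set.right_mem_Icc.2 hT)
      · exact (linearFlow_mem huI T m hm).ge
    have hlt : posSupport (n T) ⊂ I := by
      refine (Finset.ssubset_iff_of_subset fun m hm => ?_).2 ⟨m₀, hm₀, by simpa using hT₀⟩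
      by_contra h'
      exact (mem_posSupport.1 hm).ne' (linearFlow_mem huI T m h')
    obtain ⟨z, hz, hz0⟩ := ih _ hlt (norm_linearFlow hne T) hnT rfl
    -- The seam `T` belongs to the second piece: only right derivatives are required there, so the
    -- jump of the field does no harm.
    set w : ℝ → Vec M := fun t => if t < T then n t else z (t + -T) with hw
    have hwlt : ∀ t, t < T → w t = n t := fun t ht => by simp [hw, ht]
    have hwge : ∀ t, T ≤ t → w t = z (t + -T) := fun t ht => by simp [hw, ht.not_gt]
    refine ⟨w, ⟨?_, fun t ht => ?_, fun t ht => ?_⟩, ?_⟩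
    · rw [← Set.Icc_union_Ici_eq_Ici hT]
      refine ContinuousOn.union_of_isClosed ?_ ?_ isClosed_Icc isClosed_Ici
      · refine hcont.continuousOn.congr fun t ht => ?_
        rcases ht.2.lt_or_eq with h' | h'
        · exact hwlt t h'
        · rw [h', hwge T le_rfl, add_neg_cancel, hz0]
      · refine ContinuousOn.congr (f := fun t => z (t + -T)) ?_ hwge
        exact hz.continuousOn.comp (by fun_prop) fun t ht => by
          simp only [Set.mem_Ici] at ht ⊢
          linarith
    · rcases lt_or_ge t T with h' | h'
      · rw [hwlt t h']
        exact norm_linearFlow hne t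
      · rw [hwge t h']
        exact hz.norm_eq _ (by linarith)
    · rcases lt_or_ge t T with h' | h'
      · rw [hwlt t h']
        exact ((hder t (h t ⟨ht, h'⟩)).congr_of_eventuallyEq
          (Filter.mem_of_superset (Iio_mem_nhds h') hwlt)).hasDerivWithinAt
      · rw [hwge t h']
        refine (hasDerivWithinAt_add_right (-T) (hz.hasDeriv (t + -T) (by linarith))).congr
          (fun s hs => hwge s (h'.trans hs)) (hwge t h')
    · rw [hwlt 0 (lt_of_le_of_ne hT hTpos.symm), hn, linearFlow_zero h1]

/-! ### Initial values that do not select a coordinate form a null cone -/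

/-- `A` is covered by countably many `C¹` images of `ℝ^k`. -/
def SmoothlyCovered {E : Type*} [NormedAddCommGroup E] [NormedSpace ℝ E] (k : ℕ) (A : Set E) :
    Prop :=
  ∃ (ι : Type) (_ : Countable ι) (f : ι → (Fin k → ℝ) → E),
    (∀ i, ContDiff ℝ 1 (f i)) ∧ A ⊆ ⋃ i, Set.range (f i)

namespace SmoothlyCovered
variable {E : Type*} [NormedAddCommGroup E] [NormedSpace ℝ E] {k : ℕ} {A : Set E}

theorem subset (h : SmoothlyCovered k A) {B : Set E} (hB : B ⊆ A) : SmoothlyCovered k B :=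
  let ⟨ι, hι, f, hf, hA⟩ := h
  ⟨ι, hι, f, hf, hB.trans hA⟩

theorem succ (h : SmoothlyCovered k A) : SmoothlyCovered (k + 1) A := by
  obtain ⟨ι, hι, f, hf, hA⟩ := h
  refine ⟨ι, hι, fun i s => f i fun j => s j.succ, fun i => (hf i).comp (by fun_prop), fun z hz => ?_⟩
  obtain ⟨i, s, rfl⟩ := Set.mem_iUnion.1 (hA hz)
  exact Set.mem_iUnion.2 ⟨i, Fin.cons 0 s, by simp⟩

theorem mono (h : SmoothlyCovered k A) {l : ℕ} (hkl : k ≤ l) : SmoothlyCovered l A := by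
  induction l, hkl using Nat.le_induction with
  | base => exact h
  | succ l _ ih => exact ih.succ

theorem iUnion {κ : Type} [Countable κ] {B : κ → Set E} (h : ∀ j, SmoothlyCovered k (B j)) :
    SmoothlyCovered k (⋃ j, B j) := by
  choose ι hι f hf hB using h
  refine ⟨Σ j, ι j, inferInstance, fun x => f x.1 x.2, fun x => hf _ _, Set.iUnion_subset fun j => ?_⟩
  refine (hB j).trans (Set.iUnion_subset fun i => ?_)
  exact Set.subset_iUnion (fun x : Σ j, ι j => Set.range (f x.1 x.2)) ⟨j, i⟩

theorem span_singleton (p : E) : SmoothlyCovered 1 {z : E | ∃ c : ℝ, z = c • p} := by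
  refine ⟨Unit, inferInstance, fun _ s => s 0 • p, fun _ => by fun_prop, ?_⟩
  rintro _ ⟨c, rfl⟩
  exact Set.mem_iUnion.2 ⟨(), fun _ => c, rfl⟩

/-- The additional parameter is the time `t`. -/
theorem exp_smul [CompleteSpace E] (h : SmoothlyCovered k A) (B : E →L[ℝ] E) :
    SmoothlyCovered (k + 1) {z : E | ∃ t : ℝ, ∃ q ∈ A, z = NormedSpace.exp (t • B) q} := by
  obtain ⟨ι, hι, f, hf, hA⟩ := h
  have hexp : ContDiff ℝ 1 (NormedSpace.exp : (E →L[ℝ] E) → E →L[ℝ] E) := by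
    rw [← contDiffOn_univ]
    exact AnalyticOnNhd.contDiffOn (fun x _ => NormedSpace.exp_analytic (𝕂 := ℝ) x)
      uniqueDiffOn_univ
  refine ⟨ι, hι, fun i s => NormedSpace.exp (s 0 • B) (f i fun j => s j.succ), fun i => ?_, ?_⟩
  · exact (hexp.comp (by fun_prop)).clm_apply ((hf i).comp (by fun_prop))
  · rintro _ ⟨t, q, hq, rfl⟩
    obtain ⟨i, s, rfl⟩ := Set.mem_iUnion.1 (hA hq)
    exact Set.mem_iUnion.2 ⟨i, Fin.cons t s, by simp⟩

theorem image (h : SmoothlyCovered k A) {F : Type*} [NormedAddCommGroup F] [NormedSpace ℝ F]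
    (L : E →L[ℝ] F) : SmoothlyCovered k (L '' A) := by
  obtain ⟨ι, hι, f, hf, hA⟩ := h
  refine ⟨ι, hι, fun i => L ∘ f i, fun i => L.contDiff.comp (hf i), ?_⟩
  rintro _ ⟨z, hz, rfl⟩
  obtain ⟨i, s, rfl⟩ := Set.mem_iUnion.1 (hA hz)
  exact Set.mem_iUnion.2 ⟨i, s, rfl⟩

/-- A `C¹` image of `ℝ^k` has Hausdorff dimension at most `k`; no measurability of `A` is needed. -/
theorem measure_eq_zero [FiniteDimensional ℝ E] [MeasurableSpace E] [BorelSpace E]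
    (h : SmoothlyCovered k A) (μ : Measure E) [μ.IsAddHaarMeasure]
    (hk : k < Module.finrank ℝ E) : μ A = 0 := by
  obtain ⟨ι, hι, f, hf, hA⟩ := h
  refine measure_mono_null hA (measure_iUnion_null fun i => ?_)
  refine measure_zero_of_dimH_lt (d := Module.finrank ℝ E) ?_
    ((hf i).dimH_range_le.trans_lt ?_)
  · rw [NNReal.coe_natCast]
    exact Measure.absolutelyContinuous_isAddHaarMeasure _ _
  · simpa using hk

end SmoothlyCovered

/-- A cone with Lebesgue measure zero meets the sphere in a set of surface measure zero. -/
theorem ae_toSphere_notMem {E : Type*} [NormedAddCommGroup E] [NormedSpace ℝ E]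
    [FiniteDimensional ℝ E] [MeasurableSpace E] [BorelSpace E] (μ : Measure E)
    [μ.IsAddHaarMeasure] {K : Set E} (hK : μ K = 0) (hcone : ∀ (c : ℝ), ∀ z ∈ K, c • z ∈ K) :
    ∀ᵐ w : Metric.sphere (0 : E) 1 ∂μ.toSphere, (w : E) ∉ K := by
  have h1 : ∀ᵐ z : ({0}ᶜ : Set E) ∂(μ.comap (Subtype.val : ({0}ᶜ : Set E) → E)), (z : E) ∉ K := by
    rw [ae_iff]
    refine (comap_subtype_coe_apply (measurableSet_singleton (0 : E)).compl μ _).trans ?_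
    refine measure_mono_null ?_ hK
    rintro _ ⟨z, hz, rfl⟩
    simpa using hz
  -- In polar coordinates, Fubini makes almost every ray avoid `K` at almost every radius. The
  -- radial measure is nonzero, so one such radius exists, and the cone property excludes the whole
  -- ray.
  have h2 : ∀ᵐ q ∂(μ.toSphere.prod (Measure.volumeIoiPow (Module.finrank ℝ E - 1))),
      ((homeomorphUnitSphereProd E).symm q : E) ∉ K := by
    rw [← μ.measurePreserving_homeomorphUnitSphereProd.map_eq,
      (homeomorphUnitSphereProd E).measurableEmbedding.ae_map_iff]
    simpa using h1
  have h3 : Measure.volumeIoiPow (Module.finrank ℝ E - 1) ≠ 0 := fun h => by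
    have := Measure.volumeIoiPow_apply_Iio (Module.finrank ℝ E - 1) ⟨1, Set.mem_Ioi.2 one_pos⟩
    rw [h] at this
    simp only [Measure.coe_zero, Pi.zero_apply, one_pow] at this
    exact (ENNReal.ofReal_pos.2 (by positivity)).ne this
  have := ae_neBot.2 h3
  filter_upwards [Measure.ae_ae_of_ae_prod h2] with w hw hwK
  obtain ⟨r, hr⟩ := hw.exists
  exact hr (by simpa using hcone r w hwK)

/-- The cone over the initial values with support `I` of flow lines that do not converge to a
coordinate vector. -/
def unselectedCone (S : Matrix (Fin M) (Fin M) ℝ) (I : Finset (Fin M)) : Set (Vec M) :=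
  {z | ∃ (r : ℝ) (u : ℝ → Vec M), IsFlow S u ∧ (∀ m, 0 ≤ u 0 m) ∧ posSupport (u 0) = I ∧
    (¬ ∃ m, Tendsto u atTop (𝓝 (EuclideanSpace.single m 1))) ∧ z = r • u 0}

theorem smoothlyCovered_unselectedCone (hS : S.IsSymm) (hneg : ∀ m l, m ≠ l → S m l < 0)
    (I : Finset (Fin M)) : SmoothlyCovered (I.card - 1) (unselectedCone S I) := by
  induction I using Finset.strongInduction with
  | H I ih =>
    rcases Finset.eq_empty_or_nonempty I with rfl | hI
    · refine ⟨Empty, inferInstance, fun i => i.elim, fun i => i.elim, ?_⟩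
      rintro _ ⟨r, u, hu, hnn, hsupp, -, rfl⟩
      exact absurd hsupp (posSupport_nonempty hnn (hu.norm_eq 0 le_rfl)).ne_empty
    obtain ⟨μ, p, -, hpos, hpe, hμ, huniq⟩ := exists_perron hS hneg hI
    set X : Option (Finset (Fin M)) → Set (Vec M) := fun o => o.elim
      -- For a one-element `I` the rest point is a coordinate vector, which counts as selected;
      -- otherwise the line has dimension `1 ≤ I.card - 1`.
      (if I.card = 1 then ∅ else {z | ∃ c : ℝ, z = c • p})
      fun J => if J ⊂ I ∧ J.Nonempty then {z | ∃ t : ℝ, ∃ q ∈ unselectedCone S J,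
        z = NormedSpace.exp (t • -minor S I) q} else ∅ with hX
    have hempty : SmoothlyCovered (I.card - 1) (∅ : Set (Vec M)) :=
      ⟨Empty, inferInstance, fun i => i.elim, fun i => i.elim, Set.empty_subset _⟩
    refine (SmoothlyCovered.iUnion (B := X) ?_).subset ?_
    · rintro (_ | J)
      · simp only [hX, Option.elim_none]
        split_ifs with h
        · exact hempty
        · exact (SmoothlyCovered.span_singleton p).mono (by have := hI.card_pos; omega)
      · simp only [hX, Option.elim_some]
        split_ifs with h
        -- Nonemptiness of `J` matters: with truncated subtraction, `J.card - 1 + 1 = J.card` fails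
        -- at zero.
        · refine ((ih J h.1).exp_smul _).mono ?_
          have := h.2.card_pos
          have := Finset.card_lt_card h.1
          omega
        · exact hempty
    · rintro _ ⟨r, u, hu, hnn, hsupp, hsel, rfl⟩
      refine Set.mem_iUnion.2 ?_
      rcases hu.posSupport_const_or_exit hneg with h | ⟨T, hT, h, hlt⟩
      · rw [hsupp] at h
        obtain ⟨h1, h2⟩ := hu.rest_of_posSupport_const hS hpos hpe hμ hnn hI h
        have hcard : I.card ≠ 1 := fun h' => by
          obtain ⟨m, rfl⟩ := Finset.card_eq_one.1 h'
          refine hsel ⟨m, ?_⟩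
          rw [← eq_single_of_posSupport hnn (hu.norm_eq 0 le_rfl) hsupp]
          exact tendsto_const_nhds.congr' ((eventually_ge_atTop 0).mono fun t ht => (h2 t ht).symm)
        obtain ⟨c, hc⟩ := huniq _ (hsupp ▸ mem_coordSubspace_posSupport hnn) h1
        refine ⟨none, ?_⟩
        simp only [hX, Option.elim_none, if_neg hcard]
        exact ⟨r * c, by rw [hc, smul_smul]⟩
      · rw [hsupp] at h hlt
        obtain ⟨c, hc⟩ := hu.eq_smul_exp_of_posSupport_const hT h
        have hnnT : ∀ m, 0 ≤ u T m := fun m => hu.nonneg (hnn m) hT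
        refine ⟨some (posSupport (u T)), ?_⟩
        simp only [hX, Option.elim_some,
          if_pos (And.intro hlt (posSupport_nonempty hnnT (hu.norm_eq T hT)))]
        refine ⟨T, (r * c) • u T, ⟨r * c, _, hu.shift hT, by simpa using hnnT, by simp, ?_, by simp⟩,
          by rw [hc, smul_smul, map_smul]⟩
        rintro ⟨m, hm⟩
        refine hsel ⟨m, ?_⟩
        have := hm.comp (tendsto_atTop_add_const_right atTop (-T) tendsto_id)
        simpa [Function.comp_def] using this

end Dynamics

/-! ### The gradient field of the energy in the orthogonal mixture model -/

section Translation
variable {M N n : ℕ} {b : OrthonormalBasis (Fin M) ℝ (Vec M)} {x x' : Fin N → Vec M}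

/-- The interaction matrix of the modes: the Hessian of the energy on the positive orthant. -/
def interaction (α : Fin N → Fin N → ℝ) (c : Fin N → Fin M → ℝ) (γ : Fin N → ℝ) :
    Matrix (Fin M) (Fin M) ℝ :=
  Matrix.of fun m l => ∑ i, ∑ j ∈ Finset.univ.erase i, α i j *
    ((c i m - c j m) * (c i l - c j l) - (1 - γ i) ^ 2 * (c i m * c i l))

theorem interaction_isSymm (α : Fin N → Fin N → ℝ) (c : Fin N → Fin M → ℝ) (γ : Fin N → ℝ) :
    (interaction α c γ).IsSymm := by
  ext m l
  simp only [interaction, Matrix.transpose_apply, Matrix.of_apply]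
  exact Finset.sum_congr rfl fun i _ => Finset.sum_congr rfl fun j _ => by ring

theorem OrthogonalMixture.inner_mul_inner_eq_zero (h : OrthogonalMixture b x x') (i : Fin N) {m l : Fin M}
    (hml : m ≠ l) : (inner ℝ (b m) (x i) : ℝ) * inner ℝ (b l) (x i) = 0 := by
  by_contra hne
  have h1 := left_ne_zero_of_mul hne
  have h2 := right_ne_zero_of_mul hne
  exact hml (h.one_hot i m l (lt_of_le_of_ne (h.nonneg i m) h1.symm)
    (lt_of_le_of_ne (h.nonneg i l) h2.symm))

theorem interaction_neg (h : OrthogonalMixture b x x') (hcover : ∀ m, ∃ i, 0 < inner ℝ (b m) (x i))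
    {α : Fin N → Fin N → ℝ} (hα : ∀ i j, i ≠ j → 0 < α i j) (γ : Fin N → ℝ) (m l : Fin M)
    (hml : m ≠ l) : interaction α (fun i m => inner ℝ (b m) (x i)) γ m l < 0 := by
  simp only [interaction, Matrix.of_apply]
  have hterm : ∀ i j, ((inner ℝ (b m) (x i) - inner ℝ (b m) (x j)) *
      (inner ℝ (b l) (x i) - inner ℝ (b l) (x j))
      - (1 - γ i) ^ 2 * (inner ℝ (b m) (x i) * inner ℝ (b l) (x i)) : ℝ)
      = -(inner ℝ (b m) (x i) * inner ℝ (b l) (x j)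
        + inner ℝ (b m) (x j) * inner ℝ (b l) (x i)) := fun i j => by
    -- Products of two modes in one sample vanish, so augmentation affects only the diagonal.
    linear_combination (1 - (1 - γ i) ^ 2) * h.inner_mul_inner_eq_zero i hml + h.inner_mul_inner_eq_zero j hml
  have hle : ∀ i, ∀ j ∈ Finset.univ.erase i, α i j *
      ((inner ℝ (b m) (x i) - inner ℝ (b m) (x j)) * (inner ℝ (b l) (x i) - inner ℝ (b l) (x j))
      - (1 - γ i) ^ 2 * (inner ℝ (b m) (x i) * inner ℝ (b l) (x i))) ≤ 0 := fun i j hj => by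
    rw [hterm]
    refine mul_nonpos_of_nonneg_of_nonpos (hα i j (Finset.ne_of_mem_erase hj).symm).le
      (neg_nonpos.2 ?_)
    have := h.nonneg
    exact add_nonneg (mul_nonneg (this _ _) (this _ _)) (mul_nonneg (this _ _) (this _ _))
  obtain ⟨i, hi⟩ := hcover m
  obtain ⟨j, hj⟩ := hcover l
  -- Samples showing different modes are distinct, so this pair does occur in the sum and makes it
  -- strictly negative.
  have hij : i ≠ j := fun hij => hml (h.one_hot i m l hi (hij ▸ hj))
  refine Finset.sum_neg' (fun i _ => Finset.sum_nonpos (hle i)) ⟨i, Finset.mem_univ i, ?_⟩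
  refine Finset.sum_neg' (hle i) ⟨j, Finset.mem_erase.2 ⟨hij.symm, Finset.mem_univ j⟩, ?_⟩
  rw [hterm]
  refine mul_neg_of_pos_of_neg (hα i j hij) (neg_neg_of_pos ?_)
  have := h.nonneg
  exact add_pos_of_pos_of_nonneg (mul_pos hi hj) (mul_nonneg (this _ _) (this _ _))

theorem OrthogonalMixture.inner_eq (h : OrthogonalMixture b x x') (w : Vec M) (i : Fin N)
    {m : Fin M} (hm : 0 < inner ℝ (b m) (x i)) :
    inner ℝ w (x i) = b.repr w m * inner ℝ (b m) (x i) := by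
  rw [← b.sum_inner_mul_inner, Finset.sum_eq_single m]
  · rw [b.repr_apply_apply, real_inner_comm]
  · intro l _ hl
    have := h.inner_mul_inner_eq_zero i hl
    rcases mul_eq_zero.1 this with h0 | h0
    · rw [h0, mul_zero]
    · exact absurd h0 hm.ne'
  · simp

/-- If mode `m` is present in `x i`, it is the only one, so `⟨w, x i⟩` has the sign of the
coordinate of `w` along `b m`. -/
theorem OrthogonalMixture.gate_mul (h : OrthogonalMixture b x x') (w : Vec M) (i : Fin N)
    (m : Fin M) : gate w (x i) * inner ℝ (b m) (x i) =
      if 0 < b.repr w m then inner ℝ (b m) (x i) else 0 := by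
  rcases (h.nonneg i m).eq_or_lt with h0 | hpos
  · simp [← h0]
  · rw [gate, h.inner_eq w i hpos]
    by_cases hw : 0 < b.repr w m
    · simp [hw, mul_pos hw hpos]
    · simp [hw, (mul_nonpos_of_nonpos_of_nonneg (not_lt.1 hw) hpos.le).not_gt]

theorem OrthogonalMixture.hidden_eq (h : OrthogonalMixture b x x') (w : Vec M) (i : Fin N) :
    hidden w (x i) = ∑ l ∈ posSupport (b.repr w), b.repr w l * inner ℝ (b l) (x i) := by
  have h1 : hidden w (x i) = gate w (x i) * inner ℝ w (x i) := by
    unfold hidden gate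
    split_ifs with h0
    · rw [max_eq_left h0.le, one_mul]
    · rw [max_eq_right (not_lt.1 h0), zero_mul]
  rw [h1, ← b.sum_inner_mul_inner, Finset.mul_sum, posSupport, Finset.sum_filter]
  refine Finset.sum_congr rfl fun l _ => ?_
  rw [mul_left_comm, h.gate_mul, b.repr_apply_apply, real_inner_comm]
  simp

theorem hidden_smul {γ : ℝ} (hγ : 0 < γ) (w y : Vec M) : hidden w (γ • y) = γ * hidden w y := by
  rw [hidden, hidden, inner_smul_right, mul_max_of_nonneg _ _ hγ.le, mul_zero]

theorem gate_smul {γ : ℝ} (hγ : 0 < γ) (w y : Vec M) : gate w (γ • y) = gate w y := by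
  simp [gate, inner_smul_right, hγ]

theorem repr_gradLower (h : OrthogonalMixture b x x') {γ : Fin N → ℝ} (hγ : ∀ i, 0 < γ i)
    (hx' : ∀ i, x' i = γ i • x i) (α : Fin N → Fin N → ℝ) {v : Vec n} (hv : ‖v‖ = 1) (w : Vec M) :
    b.repr (gradLower α x x' v w) =
      minor (interaction α (fun i m => inner ℝ (b m) (x i)) γ) (posSupport (b.repr w))
        (b.repr w) := by
  have hout : ∀ y : Vec M, inner ℝ v (output v w y) = hidden w y := fun y => by
    rw [output, inner_smul_right, real_inner_self_eq_norm_sq, hv]; ring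
  ext m
  rw [b.repr_apply_apply, minor_apply]
  simp only [gradLower, inner_sum, inner_smul_right, inner_sub_right, hout, hx', hidden_smul (hγ _),
    gate_smul (hγ _), mem_posSupport]
  have hterm : ∀ i j, α i j * ((hidden w (x i) - hidden w (x j)) *
      (gate w (x i) * inner ℝ (b m) (x i) - gate w (x j) * inner ℝ (b m) (x j)) -
      (hidden w (x i) - γ i * hidden w (x i)) *
      (gate w (x i) * inner ℝ (b m) (x i) - gate w (x i) * (γ i * inner ℝ (b m) (x i)))) =
      if 0 < b.repr w m then ∑ l ∈ posSupport (b.repr w), α i j *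
        ((inner ℝ (b m) (x i) - inner ℝ (b m) (x j)) * (inner ℝ (b l) (x i) - inner ℝ (b l) (x j))
        - (1 - γ i) ^ 2 * (inner ℝ (b m) (x i) * inner ℝ (b l) (x i))) * b.repr w l else 0 := by
    intro i j
    rw [mul_left_comm (gate w (x i)) (γ i), h.gate_mul, h.gate_mul]
    split_ifs with hm
    -- Separating the factors of samples `i` and `j` lets the sum over `l` be evaluated by
    -- `hidden_eq`.
    · have : ∀ l, α i j *
        ((inner ℝ (b m) (x i) - inner ℝ (b m) (x j)) * (inner ℝ (b l) (x i) - inner ℝ (b l) (x j))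
        - (1 - γ i) ^ 2 * (inner ℝ (b m) (x i) * inner ℝ (b l) (x i))) * b.repr w l =
        α i j * (inner ℝ (b m) (x i) - inner ℝ (b m) (x j) -
            (1 - γ i) ^ 2 * inner ℝ (b m) (x i)) * (b.repr w l * inner ℝ (b l) (x i))
          - α i j * (inner ℝ (b m) (x i) - inner ℝ (b m) (x j)) *
            (b.repr w l * inner ℝ (b l) (x j)) := fun l => by ring
      simp only [this, Finset.sum_sub_distrib, ← Finset.mul_sum, ← h.hidden_eq]
      ring
    · ring
  simp only [hterm]
  split_ifs with hm
  · simp only [interaction, Matrix.of_apply, Finset.sum_mul]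
    exact (Finset.sum_congr rfl fun i _ => Finset.sum_comm).trans Finset.sum_comm
  · simp

theorem tangent_gradUpper (α : Fin N → Fin N → ℝ) (x x' : Fin N → Vec M) {v : Vec n}
    (hv : ‖v‖ = 1) (w : Vec M) : tangent v (gradUpper α x x' v w) = 0 := by
  obtain ⟨c, hc⟩ : ∃ c : ℝ, gradUpper α x x' v w = c • v := by
    refine ⟨∑ i, ∑ j ∈ Finset.univ.erase i, α i j *
      ((hidden w (x i) - hidden w (x j)) * (hidden w (x i) - hidden w (x j))
      - (hidden w (x i) - hidden w (x' i)) * (hidden w (x i) - hidden w (x' i))), ?_⟩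
    simp only [gradUpper, output, Finset.sum_smul, ← sub_smul, smul_smul]
  rw [tangent, hc, inner_smul_right, real_inner_self_eq_norm_sq, hv]
  simp

theorem repr_tangent (w g : Vec M) : b.repr (tangent w g) = tangent (b.repr w) (b.repr g) := by
  simp [tangent]

theorem IsTrajectory.isFlow_repr (h : OrthogonalMixture b x x') {γ : Fin N → ℝ}
    (hγ : ∀ i, 0 < γ i) (hx' : ∀ i, x' i = γ i • x i) {α : Fin N → Fin N → ℝ} {v : ℝ → Vec n}
    {w : ℝ → Vec M} (hw : IsTrajectory α x x' v w) :
    IsFlow (interaction α (fun i m => inner ℝ (b m) (x i)) γ) fun t => b.repr (w t) where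
  continuousOn := b.repr.continuous.comp_continuousOn hw.continuousOn_lower
  norm_eq t ht := by rw [LinearIsometryEquiv.norm_map, hw.norm_lower t ht]
  hasDeriv t ht := by
    have := (b.repr : Vec M →L[ℝ] Vec M).hasFDerivAt.comp_hasDerivWithinAt t (hw.flow_lower t ht)
    rw [← repr_gradLower h hγ hx' α (hw.norm_upper t ht), ← repr_tangent]
    exact this

theorem IsFlow.isTrajectory (h : OrthogonalMixture b x x') {γ : Fin N → ℝ}
    (hγ : ∀ i, 0 < γ i) (hx' : ∀ i, x' i = γ i • x i) {α : Fin N → Fin N → ℝ} {v : Vec n}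
    (hv : ‖v‖ = 1) {u : ℝ → Vec M}
    (hu : IsFlow (interaction α (fun i m => inner ℝ (b m) (x i)) γ) u) :
    IsTrajectory α x x' (fun _ => v) fun t => b.repr.symm (u t) where
  continuousOn_upper := continuousOn_const
  continuousOn_lower := b.repr.symm.continuous.comp_continuousOn hu.continuousOn
  norm_upper _ _ := hv
  norm_lower t ht := by rw [LinearIsometryEquiv.norm_map, hu.norm_eq t ht]
  flow_upper t _ := by
    rw [tangent_gradUpper α x x' hv]
    exact hasDerivWithinAt_const _ _ _
  flow_lower t ht := by
    have := (b.repr.symm : Vec M →L[ℝ] Vec M).hasFDerivAt.comp_hasDerivWithinAt t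
      (hu.hasDeriv t ht)
    refine this.congr_deriv ?_
    change b.repr.symm _ = _
    rw [LinearIsometryEquiv.symm_apply_eq, repr_tangent, repr_gradLower h hγ hx' α hv,
      LinearIsometryEquiv.apply_symm_apply]

theorem tendsto_of_tendsto_repr {w : ℝ → Vec M} {m : Fin M}
    (h : Tendsto (fun t => b.repr (w t)) atTop (𝓝 (EuclideanSpace.single m 1))) :
    Tendsto w atTop (𝓝 (b m)) := by
  have := (b.repr.symm.continuous.tendsto _).comp h
  simpa [Function.comp_def] using this

end Translation

end OneHidReLU

end

/-! ### Proof of the theorem -/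

open OneHidReLU in
theorem mainTheorem5 {M N n : ℕ}
    (b : OrthonormalBasis (Fin M) ℝ (OneHidReLU.Vec M))
    (x x' : Fin N → OneHidReLU.Vec M)
    (hmix : OneHidReLU.OrthogonalMixture b x x')
    (hcover : ∀ m, ∃ i, 0 < inner ℝ (b m) (x i))
    (α : Fin N → Fin N → ℝ) (hα : ∀ i j, i ≠ j → 0 < α i j) :
    -- from every admissible initialization the dynamics runs for all times
    (∀ (v₀ : OneHidReLU.Vec n) (w₀ : OneHidReLU.Vec M), ‖v₀‖ = 1 → ‖w₀‖ = 1 →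
      (∀ m, 0 ≤ inner ℝ (b m) w₀) →
      ∃ (v : ℝ → OneHidReLU.Vec n) (w : ℝ → OneHidReLU.Vec M),
        OneHidReLU.IsTrajectory α x x' v w ∧ v 0 = v₀ ∧ w 0 = w₀) ∧
    -- every trajectory selects a single mode, or comes to rest at a point with several modes
    (∀ (v : ℝ → OneHidReLU.Vec n) (w : ℝ → OneHidReLU.Vec M),
      OneHidReLU.IsTrajectory α x x' v w → (∀ m, 0 ≤ inner ℝ (b m) (w 0)) →
      (∃ m, Tendsto w atTop (𝓝 (b m))) ∨
      (∃ T, 0 ≤ T ∧ (∀ t, T ≤ t → w t = w T) ∧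
        ∃ m l, m ≠ l ∧ 0 < inner ℝ (b m) (w T) ∧ 0 < inner ℝ (b l) (w T))) ∧
    -- for almost every initialization a single mode is selected
    (∀ᵐ w₀ : Metric.sphere (0 : OneHidReLU.Vec M) 1
        ∂((volume : Measure (OneHidReLU.Vec M)).toSphere),
      (∀ m, 0 ≤ inner ℝ (b m) (w₀ : OneHidReLU.Vec M)) →
      ∀ (v : ℝ → OneHidReLU.Vec n) (w : ℝ → OneHidReLU.Vec M),
        OneHidReLU.IsTrajectory α x x' v w → w 0 = w₀ →
        ∃ m, Tendsto w atTop (𝓝 (b m))) := by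
  choose γ hγ hx' using hmix.augmentation
  set S := interaction α (fun i m => inner ℝ (b m) (x i)) γ with hSdef
  have hS : S.IsSymm := interaction_isSymm _ _ _
  have hneg : ∀ m l, m ≠ l → S m l < 0 := interaction_neg hmix hcover hα γ
  simp only [← b.repr_apply_apply]
  refine ⟨fun v₀ w₀ hv hw hnn => ?_, fun v w hw hnn => ?_, ?_⟩
  · obtain ⟨u, hu, hu0⟩ := exists_isFlow S (u₀ := b.repr w₀) (by simpa using hw) hnn
    exact ⟨_, _, hu.isTrajectory hmix hγ hx' hv, rfl, by simp [hu0]⟩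
  · rcases (hw.isFlow_repr hmix hγ hx').tendsto_single_or_rest hS hneg hnn with
      ⟨m, hm⟩ | ⟨T, hT, h, hml⟩
    · exact Or.inl ⟨m, tendsto_of_tendsto_repr hm⟩
    · exact Or.inr ⟨T, hT, fun t ht => b.repr.injective (h t ht), hml⟩
  -- For `M = 0` the sphere is empty, and the bound `M - 1 < M` used below would fail.
  · rcases Nat.eq_zero_or_pos M with rfl | hM
    · exact Eventually.of_forall fun w₀ => absurd (mem_sphere_zero_iff_norm.1 w₀.2)
        (by simp [Subsingleton.elim (w₀ : Vec 0) 0])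
    set K : Set (Vec M) := (b.repr.symm : Vec M →L[ℝ] Vec M) '' ⋃ I, unselectedCone S I with hK
    have hcov : SmoothlyCovered (M - 1) K :=
      (SmoothlyCovered.iUnion fun I => (smoothlyCovered_unselectedCone hS hneg I).mono
        (by have := I.card_le_univ; simp at this; omega)).image _
    have hcone : ∀ c : ℝ, ∀ z ∈ K, c • z ∈ K := by
      rintro c _ ⟨z, hz, rfl⟩
      obtain ⟨I, r, u, hu, hnn, hsupp, hsel, rfl⟩ := Set.mem_iUnion.1 hz
      exact ⟨(c * r) • u 0, Set.mem_iUnion.2 ⟨I, c * r, u, hu, hnn, hsupp, hsel, rfl⟩, by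
        rw [← map_smul, smul_smul]⟩
    filter_upwards [ae_toSphere_notMem volume
      (hcov.measure_eq_zero volume (by rw [finrank_euclideanSpace_fin]; omega)) hcone]
      with w₀ hw₀ hnn v w hw hw0
    by_contra hsel
    -- The cone collects the starts of all unselected flow lines, so one bad trajectory from `w₀`
    -- suffices and uniqueness is not needed.
    refine hw₀ ⟨b.repr w₀, Set.mem_iUnion.2 ⟨_, 1, _, hw.isFlow_repr hmix hγ hx',
      fun m => ?_, rfl, ?_, by rw [hw0, one_smul]⟩, by simp⟩
    · rw [hw0]
      exact hnn m
    · rintro ⟨m, hm⟩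
      exact hsel ⟨m, tendsto_of_tendsto_repr hm⟩
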